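/- Let $t>0$ and let $\mathbb{T}=\mathbb{R}^2/(t^{-1/2}\mathbb{Z}\times t^{-1/2}\mathbb{Z})$ be the square torus of area $1/t$. Its heat kernel (with respect to the uniform probability measure on $\mathbb{T}$, at time $1$ after rescaling time by the factor $1/(4\pi)$) is $$p\big((x_1,y_1),(x_2,y_2)\big)=\sum_{(k,l)\in\mathbb{Z}^2}e^{-\pi t(k^2+l^2)}\,e^{2\pi i\sqrt t\,(k(x_1-x_2)+l(y_1-y_2))}.$$ Write $\theta_3(q)=\sum_{k\in\mathbb{Z}}q^{k^2}$ and $\theta_4(q)=\sum_{k\in\mathbb{Z}}(-1)^kq^{k^2}$ for $0<q<1$, and let ${}_2F_1$ be Gauss' hypergeometric function. Then $p$ is real-valued and attains a minimum $A(1;t)$ (the coldest temperature) and a maximum $B(1;t)$ (the hottest temperature) on $\mathbb{T}\times\mathbb{T}$; the ratio $k'=A(1;t)/B(1;t)$ lies in $(0,1)$; and $$B(1;t)=\theta_3(e^{-\pi t})^2={}_2F_1\!\left(\tfrac12,\tfrac12;1;1-k'^2\right),\qquad A(1;t)=k'\;{}_2F_1\!\left(\tfrac12,\tfrac12;1;1-k'^2\right).$$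 Equivalently, $$k'^2=\frac{\theta_4(e^{-\pi t})^4}{\theta_3(e^{-\pi t})^4}=\frac{A(1;t)^2}{B(1;t)^2}.$$ -/

import Mathlib

noncomputable section

namespace RectTorus

/-- The torus `ℝ² / ((1/√t) (α⁻¹ ℤ × α ℤ))`, of surface area `1/t`, as a product of two circles of
lengths `α⁻¹ / √t` and `α / √t`. -/
abbrev Torus (α t : ℝ) : Type :=
  AddCircle (α⁻¹ / Real.sqrt t) × AddCircle (α / Real.sqrt t)

/-- The eigenfunctions `(x, y) ↦ exp (2 π i √t (α k x + α⁻¹ l y))` of the Laplacian; in Mathlib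
`fourier n` is the function `x ↦ exp (2 π i n x / T)` on the circle `AddCircle T`. -/
def eigenfunction (α t : ℝ) (n : ℤ × ℤ) (P : Torus α t) : ℂ :=
  fourier n.1 P.1 * fourier n.2 P.2

/-- The eigenvalue of the (non-negative) Laplacian belonging to `eigenfunction α t n`. -/
def eigenvalue (α t : ℝ) (n : ℤ × ℤ) : ℝ :=
  4 * Real.pi ^ 2 * (t * (α ^ 2 * (n.1 : ℝ) ^ 2 + (α⁻¹) ^ 2 * (n.2 : ℝ) ^ 2))

/-- The heat kernel of the torus at time `s` by its spectral expansion (the torus carries its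
uniform probability measure, for which the eigenfunctions are orthonormal). -/
def heatKernel (α t s : ℝ) (P Q : Torus α t) : ℂ :=
  ∑' n : ℤ × ℤ, (Real.exp (-(eigenvalue α t n * s)) : ℂ) *
    (eigenfunction α t n P * (starRingEnd ℂ) (eigenfunction α t n Q))

/-- The heat kernel at unit time, time being rescaled by `s ↦ s / (4 π)`. -/
def unitHeatKernel (α t : ℝ) (P Q : Torus α t) : ℂ :=
  heatKernel α t (1 / (4 * Real.pi)) P Q

/-- The set of all temperatures on the torus. -/
def temperatures (α t : ℝ) : Set ℝ :=
  Set.range fun PQ : Torus α t × Torus α t => (unitHeatKernel α t PQ.1 PQ.2).re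

/-- The coldest temperature `A(α; t)`. -/
def coldest (α t : ℝ) : ℝ := sInf (temperatures α t)

/-- The hottest temperature `B(α; t)`. -/
def hottest (α t : ℝ) : ℝ := sSup (temperatures α t)

/-- The theta-null `θ₃(q) = ∑ q^(k²)`, `k ∈ ℤ`. -/
def theta3 (q : ℝ) : ℝ := ∑' k : ℤ, q ^ (k ^ 2)

/-- The theta-null `θ₄(q) = ∑ (-1)^k q^(k²)`, `k ∈ ℤ`. -/
def theta4 (q : ℝ) : ℝ := ∑' k : ℤ, (-1 : ℝ) ^ k * q ^ (k ^ 2)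

end RectTorus

end

/-!
On the square torus the heat kernel at unit time factors as `θ(x, t) θ(y, t)`, where `x` and `y` are
the rescaled coordinate differences and `θ(x, t) = ∑ₖ exp (-π t k²) cos (2 π k x)` is Jacobi's theta
function (`unitHeatKernel_coe`). Thus everything is reduced to `θ`. Its maximum is `θ(0, t)`, by
comparing terms; the substance is that its minimum is `θ(1/2, t) > 0`, and that `θ(0, t)²` is a value
of the hypergeometric function.

Both facts rest on the duplication formula `theta_mul_add_mul` relating `t` to `2t`, together with
`θ(x, t) → 1` as `t → ∞`.

*Minimum.* The duplication formula gives
`θ(x, t) θ(x + 1/2, t) = θ(2x + 1/2, 2t) θ(1/2, 2t)`. If `θ(·, 2t)` is positive then `θ(·, t)` has no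
zero, hence is positive; as `θ(·, t)` is close to `1` for large `t`, it is positive for all `t`
(`theta_pos`). Bounding `θ(x + 1/2, t)` by `θ(0, t)` in the formula, and using
`θ(0, t) θ(1/2, t) = θ(1/2, 2t)²`, yields
`θ(x, t) / θ(1/2, t) ≥ θ(2x + 1/2, 2t) / θ(1/2, 2t)`. Iterating `n` times bounds the left side below
by a quotient which tends to `1` with `n`, so `θ(1/2, t) ≤ θ(x, t)` (`theta_half_le`).

*Hypergeometric function.* By the same formula, `(θ(0, t)², θ(1/2, t)²) = (a, b)` is sent to its pair
of arithmetic and geometric means by `t ↦ 2t`. Writing `F` for `₂F₁(1/2, 1/2; 1; ·)`, the quantity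
`F (1 - (b / a)²) / a` is unchanged under this step: this is Gauss' transformation
`F (4x / (1 + x)²) = (1 + x) F (x²)` (`ordinaryHypergeometric_landen`), obtained by expanding
`∫ ‖1 + x exp (2iy)‖⁻¹ dy` over `[0, π]` in two ways. Along `t, 2t, 4t, …` the quantity
tends to `F 0 = 1`, whence `θ(0, t)² = F (1 - (b / a)²)`
(`theta_zero_sq_eq_ordinaryHypergeometric`).
-/

/-! ### The duplication formula for the two-variable theta function -/

lemma jacobiTheta₂_term_add_mul_term_sub (z w τ : ℂ) (a b : ℤ) :
    jacobiTheta₂_term (a + b) z τ * jacobiTheta₂_term (a - b) w τ =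
      jacobiTheta₂_term a (z + w) (2 * τ) * jacobiTheta₂_term b (z - w) (2 * τ) := by
  simp only [jacobiTheta₂_term, ← Complex.exp_add]
  congr 1
  push_cast
  ring

lemma jacobiTheta₂_term_add_half (n : ℤ) (z τ : ℂ) :
    jacobiTheta₂_term n (z + 1 / 2) τ = (-1) ^ n * jacobiTheta₂_term n z τ := by
  simp only [jacobiTheta₂_term]
  rw [← Complex.exp_pi_mul_I, ← Complex.exp_int_mul, ← Complex.exp_add]
  congr 1
  ring

lemma hasSum_mul_prod {ι κ : Type*} {f : ι → ℂ} {g : κ → ℂ} {a b : ℂ} (hf : HasSum f a)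
    (hg : HasSum g b) : HasSum (fun p : ι × κ ↦ f p.1 * g p.2) (a * b) :=
  hf.mul hg (summable_mul_of_summable_norm hf.summable.norm hg.summable.norm)

lemma hasSum_jacobiTheta₂_term_mul (u v : ℂ) {τ : ℂ} (hτ : 0 < τ.im) :
    HasSum (fun p : ℤ × ℤ ↦ jacobiTheta₂_term p.1 u τ * jacobiTheta₂_term p.2 v τ)
      (jacobiTheta₂ u τ * jacobiTheta₂ v τ) := by
  have h := hasSum_mul_prod (hasSum_jacobiTheta₂_term u hτ) (hasSum_jacobiTheta₂_term v hτ)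
  exact h

/-- Duplication formula. Shifting both arguments by `1 / 2` multiplies the `(m, n)` term of the double
series by `(-1) ^ (m + n)`, so that only the terms `(m, n) = (a + b, a - b)` survive in the sum, and
these split since `m ^ 2 + n ^ 2 = 2 (a ^ 2 + b ^ 2)`. -/
theorem jacobiTheta₂_mul_add_mul (z w : ℂ) {τ : ℂ} (hτ : 0 < τ.im) :
    jacobiTheta₂ z τ * jacobiTheta₂ w τ + jacobiTheta₂ (z + 1 / 2) τ * jacobiTheta₂ (w + 1 / 2) τ =
      2 * (jacobiTheta₂ (z + w) (2 * τ) * jacobiTheta₂ (z - w) (2 * τ)) := by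
  have hτ2 : 0 < (2 * τ).im := by simpa using hτ
  have h1 := (hasSum_jacobiTheta₂_term_mul z w hτ).add
    (hasSum_jacobiTheta₂_term_mul (z + 1 / 2) (w + 1 / 2) hτ)
  have h2 := (hasSum_jacobiTheta₂_term_mul (z + w) (z - w) hτ2).mul_left 2
  obtain ⟨i, hidef⟩ : ∃ i : ℤ × ℤ → ℤ × ℤ, ∀ a b, i (a, b) = (a + b, a - b) :=
    ⟨fun p ↦ (p.1 + p.2, p.1 - p.2), fun _ _ ↦ rfl⟩
  have hi : Function.Injective i := by
    rintro ⟨a, b⟩ ⟨c, d⟩ h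
    simp only [hidef, Prod.mk.injEq] at h ⊢
    omega
  -- The range of `i` consists of the pairs with even sum.
  refine h1.unique ((hi.hasSum_iff ?_).mp (h2.congr_fun ?_))
  · rintro ⟨m, n⟩ hmn
    have hodd : Odd (m + n) := by
      by_contra hev
      rw [Int.not_odd_iff_even] at hev
      obtain ⟨c, hc⟩ := hev
      exact hmn ⟨(c, m - c), by simp only [hidef, Prod.mk.injEq]; omega⟩
    have hsign : (-1 : ℂ) ^ m * (-1) ^ n = -1 := by
      rw [← zpow_add₀ (by norm_num), hodd.neg_one_zpow]
    simp only [jacobiTheta₂_term_add_half]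
    linear_combination jacobiTheta₂_term m z τ * jacobiTheta₂_term n w τ * hsign
  · rintro ⟨a, b⟩
    have hsign : (-1 : ℂ) ^ (a + b) * (-1) ^ (a - b) = 1 := by
      rw [← zpow_add₀ (by norm_num), show a + b + (a - b) = a + a by ring,
        Even.neg_one_zpow ⟨a, rfl⟩]
    simp only [Function.comp_apply, hidef, jacobiTheta₂_term_add_half]
    linear_combination 2 * jacobiTheta₂_term_add_mul_term_sub z w τ a b +
      jacobiTheta₂_term (a + b) z τ * jacobiTheta₂_term (a - b) w τ * hsign

/-! ### The real theta function and its minimum -/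

namespace RectTorus

/-- The theta function `∑ₖ exp (-π t k²) exp (2 π i k x)` at a real point `x` and modulus `i t`. Its
values are real (`ofReal_theta`), so that taking the real part loses nothing. -/
noncomputable def theta (x t : ℝ) : ℝ := (jacobiTheta₂ x (t * Complex.I)).re

variable {t : ℝ}

lemma ofReal_theta (x t : ℝ) : (theta x t : ℂ) = jacobiTheta₂ x (t * Complex.I) := by
  rw [theta, ← Complex.conj_eq_iff_re, jacobiTheta₂_conj]
  simp

lemma im_ofReal_mul_I_pos (ht : 0 < t) : 0 < ((t : ℂ) * Complex.I).im := by simpa using ht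

theorem theta_mul_add_mul (x y : ℝ) (ht : 0 < t) :
    theta x t * theta y t + theta (x + 1 / 2) t * theta (y + 1 / 2) t =
      2 * (theta (x + y) (2 * t) * theta (x - y) (2 * t)) := by
  have h := jacobiTheta₂_mul_add_mul x y (im_ofReal_mul_I_pos ht)
  rw [← Complex.ofReal_inj]
  push_cast [ofReal_theta]
  simpa [mul_assoc] using h

lemma theta_neg (x t : ℝ) : theta (-x) t = theta x t := by
  simp [theta, jacobiTheta₂_neg_left]

lemma theta_add_one (x t : ℝ) : theta (x + 1) t = theta x t := by
  simp [theta, jacobiTheta₂_add_left]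

lemma theta_mul_theta_add_half (x : ℝ) (ht : 0 < t) :
    theta x t * theta (x + 1 / 2) t = theta (2 * x + 1 / 2) (2 * t) * theta (1 / 2) (2 * t) := by
  have h := theta_mul_add_mul x (x + 1 / 2) ht
  rw [show x + 1 / 2 + 1 / 2 = x + 1 by ring, theta_add_one,
    show x - (x + 1 / 2) = -(1 / 2) by ring, theta_neg,
    show x + (x + 1 / 2) = 2 * x + 1 / 2 by ring] at h
  linarith

lemma theta_sq_add_theta_half_sq (ht : 0 < t) :
    theta 0 t ^ 2 + theta (1 / 2) t ^ 2 = 2 * theta 0 (2 * t) ^ 2 := by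
  have h := theta_mul_add_mul 0 0 ht
  simp only [zero_add, sub_zero] at h
  linarith

lemma theta_zero_mul_theta_half (ht : 0 < t) :
    theta 0 t * theta (1 / 2) t = theta (1 / 2) (2 * t) ^ 2 := by
  have h := theta_mul_theta_add_half 0 ht
  simp only [zero_add, mul_zero] at h
  linarith

lemma hasSum_theta (x : ℝ) (ht : 0 < t) :
    HasSum (fun k : ℤ ↦ Real.exp (-(Real.pi * t)) ^ (k ^ 2) * Real.cos (2 * Real.pi * k * x))
      (theta x t) := by
  have h := Complex.hasSum_re (hasSum_jacobiTheta₂_term x (im_ofReal_mul_I_pos ht))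
  refine h.congr_fun fun k ↦ ?_
  rw [jacobiTheta₂_term, ← Real.rpow_intCast, ← Real.exp_mul, Complex.exp_re]
  congr 2
  · simp [pow_two]; ring
  · simp [pow_two]

lemma theta3_eq (ht : 0 < t) : theta3 (Real.exp (-(Real.pi * t))) = theta 0 t := by
  rw [theta3, ← (hasSum_theta 0 ht).tsum_eq]
  simp

lemma theta4_eq (ht : 0 < t) : theta4 (Real.exp (-(Real.pi * t))) = theta (1 / 2) t := by
  rw [theta4, ← (hasSum_theta (1 / 2) ht).tsum_eq]
  refine tsum_congr fun k ↦ ?_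
  rw [show 2 * Real.pi * k * (1 / 2) = k * Real.pi by ring, Real.cos_int_mul_pi, mul_comm]

lemma continuous_theta (ht : 0 < t) : Continuous fun x ↦ theta x t :=
  continuous_iff_continuousAt.mpr fun x ↦ Complex.continuous_re.continuousAt.comp <|
    (differentiableAt_jacobiTheta₂_fst x (im_ofReal_mul_I_pos ht)).continuousAt.comp
      Complex.continuous_ofReal.continuousAt

lemma theta_le_theta_zero (x : ℝ) (ht : 0 < t) : theta x t ≤ theta 0 t := by
  refine hasSum_le (fun k ↦ ?_) (hasSum_theta x ht) (hasSum_theta 0 ht)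
  simp only [mul_zero, Real.cos_zero]
  gcongr
  exact Real.cos_le_one _

lemma one_le_theta_zero (ht : 0 < t) : 1 ≤ theta 0 t := by
  have h := hasSum_theta 0 ht
  simpa using le_hasSum h 0 fun k _ ↦ by simp; positivity

/-- Equivalent to `1 - θ(x, t) ≤ θ(0, t) - 1`: the terms with `k ≠ 0` of `θ(x, t)` are at least the
negatives of those of `θ(0, t)`. -/
lemma two_sub_theta_zero_le (x : ℝ) (ht : 0 < t) : 2 - theta 0 t ≤ theta x t := by
  have h := (hasSum_theta 0 ht).add (hasSum_theta x ht)
  have h2 := le_hasSum h 0 fun k _ ↦ by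
    have := Real.neg_one_le_cos (2 * Real.pi * k * x)
    rw [← mul_add]
    refine mul_nonneg (by positivity) ?_
    simp only [mul_zero, Real.cos_zero]
    linarith
  norm_num at h2
  linarith

lemma tendsto_theta_zero : Filter.Tendsto (fun t ↦ theta 0 t) Filter.atTop (nhds 1) := by
  have hb : Filter.Tendsto
      (fun t : ℝ ↦ 2 / (1 - Real.exp (-Real.pi * t)) * Real.exp (-Real.pi * t))
      Filter.atTop (nhds (2 / (1 - 0) * 0)) := by
    have he : Filter.Tendsto (fun t : ℝ ↦ Real.exp (-Real.pi * t)) Filter.atTop (nhds 0) :=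
      Real.tendsto_exp_atBot.comp
        (Filter.tendsto_id.const_mul_atTop_of_neg (neg_neg_of_pos Real.pi_pos))
    exact (tendsto_const_nhds.div (tendsto_const_nhds.sub he) (by norm_num)).mul he
  rw [mul_zero] at hb
  refine tendsto_iff_norm_sub_tendsto_zero.mpr (squeeze_zero' (.of_forall fun _ ↦ norm_nonneg _)
    ?_ hb)
  filter_upwards [Filter.eventually_gt_atTop 0] with t ht
  have h := norm_jacobiTheta_sub_one_le (im_ofReal_mul_I_pos ht)
  have h0 : jacobiTheta (t * Complex.I) = (theta 0 t : ℂ) := by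
    rw [jacobiTheta_eq_jacobiTheta₂, ofReal_theta, Complex.ofReal_zero]
  rw [h0, ← Complex.ofReal_one, ← Complex.ofReal_sub, Complex.norm_real] at h
  simpa using h

lemma tendsto_theta_zero_two_pow_mul (ht : 0 < t) :
    Filter.Tendsto (fun n : ℕ ↦ theta 0 (2 ^ n * t)) Filter.atTop (nhds 1) :=
  tendsto_theta_zero.comp
    ((tendsto_pow_atTop_atTop_of_one_lt one_lt_two).atTop_mul_const ht)

/-- A zero of `θ(·, t)` would make the left side of `theta_mul_theta_add_half` vanish, while the right
side is positive. -/
lemma theta_pos_of_two_mul (ht : 0 < t) (h : ∀ x, 0 < theta x (2 * t)) (x : ℝ) :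
    0 < theta x t := by
  by_contra! hx
  have h0 : (0 : ℝ) ≤ theta 0 t := zero_le_one.trans (one_le_theta_zero ht)
  obtain ⟨y, hy⟩ := mem_range_of_exists_le_of_exists_ge (continuous_theta ht) ⟨x, hx⟩ ⟨0, h0⟩
  have := theta_mul_theta_add_half y ht
  rw [show theta y t = 0 from hy, zero_mul] at this
  exact (mul_pos (h _) (h _)).ne this

theorem theta_pos (x : ℝ) (ht : 0 < t) : 0 < theta x t := by
  -- `θ(x, s) ≥ 2 - θ(0, s) > 0` for `s = 2 ^ n * t` with `n` large; descend from there to `t`.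
  obtain ⟨n, hn⟩ :=
    ((tendsto_theta_zero_two_pow_mul ht).eventually_lt_const one_lt_two).exists
  induction n generalizing t x with
  | zero =>
    have := two_sub_theta_zero_le x ht
    simp only [pow_zero, one_mul] at hn
    linarith
  | succ n ih =>
    refine theta_pos_of_two_mul ht (fun y ↦ ih y (by positivity) ?_) x
    rwa [← mul_assoc, ← pow_succ]

/-- Follows from `theta_mul_theta_add_half` on bounding `θ(x + 1/2, t)` by `θ(0, t)`. -/
lemma theta_div_theta_half_le (x : ℝ) (ht : 0 < t) :
    theta (2 * x + 1 / 2) (2 * t) / theta (1 / 2) (2 * t) ≤ theta x t / theta (1 / 2) t := by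
  have ht2 : 0 < 2 * t := by positivity
  have h1 := theta_mul_theta_add_half x ht
  have h2 := theta_zero_mul_theta_half ht
  have hh := theta_pos (1 / 2) ht
  have hh2 := theta_pos (1 / 2) ht2
  have hle := mul_le_mul_of_nonneg_left (theta_le_theta_zero (x + 1 / 2) ht) (theta_pos x ht).le
  rw [div_le_div_iff₀ hh2 hh]
  refine le_of_mul_le_mul_right ?_ hh2
  calc theta (2 * x + 1 / 2) (2 * t) * theta (1 / 2) t * theta (1 / 2) (2 * t)
      = theta x t * theta (x + 1 / 2) t * theta (1 / 2) t := by rw [h1]; ring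
    _ ≤ theta x t * theta 0 t * theta (1 / 2) t := by gcongr
    _ = theta x t * theta (1 / 2) (2 * t) * theta (1 / 2) (2 * t) := by
      rw [mul_assoc, h2]; ring

/-- The `n`-fold iterate of `theta_div_theta_half_le`, combined with the bounds
`2 - θ(0, s) ≤ θ(·, s) ≤ θ(0, s)` at `s = 2 ^ n * t` and cleared of the denominator `θ(0, s)`. -/
lemma two_sub_theta_zero_two_pow_mul_le (n : ℕ) (x : ℝ) (ht : 0 < t) :
    2 - theta 0 (2 ^ n * t) ≤ theta 0 (2 ^ n * t) * (theta x t / theta (1 / 2) t) := by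
  induction n generalizing t x with
  | zero =>
    rw [pow_zero, one_mul]
    have h := two_sub_theta_zero_le x ht
    have h0 := theta_pos x ht
    have hh := theta_pos (1 / 2) ht
    have h1 : 1 ≤ theta 0 t / theta (1 / 2) t :=
      (one_le_div hh).mpr (theta_le_theta_zero _ ht)
    calc 2 - theta 0 t ≤ theta x t * 1 := by linarith
      _ ≤ theta x t * (theta 0 t / theta (1 / 2) t) := by gcongr
      _ = _ := by ring
  | succ n ih =>
    have h := ih (2 * x + 1 / 2) (t := 2 * t) (by positivity)
    rw [← mul_assoc, ← pow_succ] at h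
    have h0 : 0 < theta 0 (2 ^ (n + 1) * t) := theta_pos 0 (by positivity)
    exact h.trans (mul_le_mul_of_nonneg_left (theta_div_theta_half_le x ht) h0.le)

theorem theta_half_le (x : ℝ) (ht : 0 < t) : theta (1 / 2) t ≤ theta x t := by
  have hl := tendsto_theta_zero_two_pow_mul ht
  have h := le_of_tendsto_of_tendsto' (hl.const_sub 2) (hl.mul_const _)
    fun n ↦ two_sub_theta_zero_two_pow_mul_le n x ht
  rw [one_mul] at h
  exact (one_le_div (theta_pos (1 / 2) ht)).mp (by linarith)

lemma theta_half_lt_theta_zero (ht : 0 < t) : theta (1 / 2) t < theta 0 t := by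
  refine hasSum_lt (i := 1) (fun k ↦ ?_) ?_ (hasSum_theta (1 / 2) ht) (hasSum_theta 0 ht)
  · simp only [mul_zero, Real.cos_zero]
    gcongr
    exact Real.cos_le_one _
  -- The terms with `k = 1` have opposite signs.
  · gcongr
    rw [show 2 * Real.pi * ((1 : ℤ) : ℝ) * (1 / 2) = Real.pi by push_cast; ring]
    norm_num

/-! ### Gauss' quadratic transformation of the hypergeometric function -/

/-- The coefficient `(1/2)ₙ / n! = (1 · 3 ⋯ (2n - 1)) / (2 · 4 ⋯ (2n))` of `zⁿ` in the binomial series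
of `(1 - z) ^ (-1/2)`. It is also the mean value of `sin ^ (2n)` over `[0, π]`. -/
noncomputable def invSqrtCoeff (n : ℕ) : ℝ := ∏ i ∈ Finset.range n, (2 * (i : ℝ) + 1) / (2 * i + 2)

lemma invSqrtCoeff_nonneg (n : ℕ) : 0 ≤ invSqrtCoeff n :=
  Finset.prod_nonneg fun _ _ ↦ by positivity

lemma invSqrtCoeff_le_one (n : ℕ) : invSqrtCoeff n ≤ 1 :=
  Finset.prod_le_one (fun _ _ ↦ by positivity) fun i _ ↦
    (div_le_one (by positivity)).mpr (by linarith)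

lemma ascPochhammer_eval_half {K : Type*} [Field K] [CharZero K] (n : ℕ) :
    (ascPochhammer K n).eval (1 / 2) =
      n.factorial * ∏ i ∈ Finset.range n, (2 * (i : K) + 1) / (2 * i + 2) := by
  induction n with
  | zero => simp
  | succ n ih =>
    have h : (n : K) + 1 ≠ 0 := by exact_mod_cast n.succ_ne_zero
    rw [ascPochhammer_succ_eval, ih, Finset.prod_range_succ, Nat.factorial_succ]
    push_cast
    rw [show (2 * (n : K) + 2) = 2 * (n + 1) by ring]
    field_simp
    ring

lemma choose_half_add_sub_one (n : ℕ) :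
    Ring.choose ((1 / 2 : ℂ) + n - 1) n = (invSqrtCoeff n : ℂ) := by
  have hn : (n.factorial : ℂ) ≠ 0 := by exact_mod_cast n.factorial_ne_zero
  rw [← Ring.multichoose_eq]
  have h := Ring.factorial_nsmul_multichoose_eq_ascPochhammer (1 / 2 : ℂ) n
  rw [nsmul_eq_mul, Polynomial.ascPochhammer_smeval_eq_eval, ascPochhammer_eval_half] at h
  rw [mul_left_cancel₀ hn h, invSqrtCoeff]
  push_cast
  rfl

lemma hasSum_invSqrtCoeff_mul_pow {z : ℂ} (hz : ‖z‖ < 1) :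
    HasSum (fun n ↦ (invSqrtCoeff n : ℂ) * z ^ n) (1 / (1 - z) ^ (1 / 2 : ℂ)) := by
  have h := (Complex.one_div_one_sub_cpow_hasFPowerSeriesOnBall_zero (1 / 2)).hasSum
    (y := z) (by simpa [enorm_eq_nnnorm] using! hz)
  simp only [FormalMultilinearSeries.ofScalars_apply_eq, choose_half_add_sub_one, smul_eq_mul,
    zero_add] at h
  exact h

/-- At `z = 0` both sides are `0`, by the conventions `0 ^ (1 / 2) = 0` and `1 / 0 = 0`. -/
lemma norm_one_div_cpow_half_sq (z : ℂ) :
    ‖1 / z ^ (1 / 2 : ℂ)‖ ^ 2 = 1 / ‖z‖ := by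
  rw [← norm_pow, div_pow, one_pow, ← Complex.cpow_nat_mul]
  norm_num

lemma hasSum_invSqrtCoeff_mul_pow_real {u : ℝ} (hu0 : 0 ≤ u) (hu : u < 1) :
    HasSum (fun n ↦ invSqrtCoeff n * u ^ n) (1 / √(1 - u)) := by
  have h := hasSum_invSqrtCoeff_mul_pow (z := u) (by simpa [abs_of_nonneg hu0] using hu)
  have he : 1 / (1 - (u : ℂ)) ^ (1 / 2 : ℂ) = ((1 / √(1 - u) : ℝ) : ℂ) := by
    rw [Real.sqrt_eq_rpow]
    push_cast [Complex.ofReal_cpow (sub_nonneg.mpr hu.le)]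
    rfl
  rw [he] at h
  exact_mod_cast h

lemma ordinaryHypergeometric_half_half_one (x : ℝ) :
    ordinaryHypergeometric (1 / 2 : ℝ) (1 / 2 : ℝ) (1 : ℝ) x = ∑' n, invSqrtCoeff n ^ 2 * x ^ n := by
  rw [ordinaryHypergeometric_eq_tsum]
  refine tsum_congr fun n ↦ ?_
  have hn : (n.factorial : ℝ) ≠ 0 := by exact_mod_cast n.factorial_ne_zero
  rw [ascPochhammer_eval_half, ascPochhammer_eval_one, smul_eq_mul, ← invSqrtCoeff]
  field_simp

lemma hasSum_ordinaryHypergeometric_half_half_one {x : ℝ} (hx : |x| < 1) :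
    HasSum (fun n ↦ invSqrtCoeff n ^ 2 * x ^ n)
      (ordinaryHypergeometric (1 / 2 : ℝ) (1 / 2 : ℝ) (1 : ℝ) x) := by
  rw [ordinaryHypergeometric_half_half_one]
  refine (Summable.of_norm_bounded (summable_geometric_of_lt_one (abs_nonneg x) hx)
    fun n ↦ ?_).hasSum
  rw [norm_mul, norm_pow, norm_pow, Real.norm_eq_abs, Real.norm_eq_abs,
    abs_of_nonneg (invSqrtCoeff_nonneg n)]
  exact mul_le_of_le_one_left (by positivity)
    (pow_le_one₀ (invSqrtCoeff_nonneg n) (invSqrtCoeff_le_one n))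

/-- A series of continuous functions with a summable uniform bound may be integrated term by term. -/
lemma hasSum_integral_of_norm_le {ι E : Type*} [Countable ι] [NormedAddCommGroup E]
    [NormedSpace ℝ E] {F : ι → ℝ → E} {f : ℝ → E} {b : ι → ℝ} {u v : ℝ}
    (hF : ∀ i, Continuous (F i)) (hb : ∀ i x, ‖F i x‖ ≤ b i) (hs : Summable b)
    (hf : ∀ x, HasSum (fun i ↦ F i x) (f x)) :
    HasSum (fun i ↦ ∫ x in u..v, F i x) (∫ x in u..v, f x) :=
  intervalIntegral.hasSum_integral_of_dominated_convergence (fun i _ ↦ b i)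
    (fun i ↦ (hF i).aestronglyMeasurable) (fun i ↦ .of_forall fun x _ ↦ hb i x)
    (.of_forall fun _ _ ↦ hs) intervalIntegrable_const (.of_forall fun x _ ↦ hf x)

/-- The complete elliptic integral of the first kind, expanded by the binomial series in
`m sin² x` and Wallis' formula. -/
theorem integral_one_div_sqrt_one_sub_mul_sin_sq {m : ℝ} (hm0 : 0 ≤ m) (hm : m < 1) :
    ∫ x in 0..Real.pi, 1 / √(1 - m * Real.sin x ^ 2) =
      Real.pi * ordinaryHypergeometric (1 / 2 : ℝ) (1 / 2 : ℝ) (1 : ℝ) m := by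
  have hle (x : ℝ) : m * Real.sin x ^ 2 ≤ m := mul_le_of_le_one_right hm0 (Real.sin_sq_le_one x)
  have h := hasSum_integral_of_norm_le (u := 0) (v := Real.pi) (b := fun n : ℕ ↦ m ^ n)
    (F := fun n x ↦ invSqrtCoeff n * (m * Real.sin x ^ 2) ^ n)
    (f := fun x ↦ 1 / √(1 - m * Real.sin x ^ 2))
    (fun n ↦ by fun_prop) (fun n x ↦ by
      have h0 : 0 ≤ m * Real.sin x ^ 2 := by positivity
      rw [Real.norm_of_nonneg (mul_nonneg (invSqrtCoeff_nonneg n) (pow_nonneg h0 n))]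
      exact (mul_le_of_le_one_left (pow_nonneg h0 n) (invSqrtCoeff_le_one n)).trans
        (pow_le_pow_left₀ h0 (hle x) n))
    (summable_geometric_of_lt_one hm0 hm)
    (fun x ↦ hasSum_invSqrtCoeff_mul_pow_real (by positivity) ((hle x).trans_lt hm))
  refine h.unique (((hasSum_ordinaryHypergeometric_half_half_one
    (by rwa [abs_of_nonneg hm0])).mul_left Real.pi).congr_fun fun n ↦ ?_)
  simp only [mul_pow, ← pow_mul]
  rw [intervalIntegral.integral_const_mul, intervalIntegral.integral_const_mul,
    integral_sin_pow_even, ← invSqrtCoeff]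
  ring

lemma integral_exp_two_mul_int_mul_I (k : ℤ) :
    ∫ x in 0..Real.pi, Complex.exp (2 * k * Complex.I * x) = if k = 0 then (Real.pi : ℂ) else 0 := by
  split_ifs with hk
  · simp [hk]
  · have hk' : 2 * (k : ℂ) * Complex.I ≠ 0 := by simp [hk]
    rw [integral_exp_mul_complex hk',
      show 2 * (k : ℂ) * Complex.I * Real.pi = k * (2 * Real.pi * Complex.I) by ring,
      Complex.exp_int_mul_two_pi_mul_I]
    simp

lemma hasSum_mul_conj_of_hasSum {a : ℕ → ℂ} {s : ℂ} (h : HasSum a s) :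
    HasSum (fun p : ℕ × ℕ ↦ a p.1 * (starRingEnd ℂ) (a p.2)) ((‖s‖ ^ 2 : ℝ) : ℂ) := by
  have := hasSum_mul_prod h (Complex.hasSum_conj'.mpr h)
  rwa [Complex.mul_conj, Complex.normSq_eq_norm_sq] at this

/-- With `w = -x exp (2iy)`, the integrand is `‖(1 - w) ^ (-1/2)‖²`; expanding this as the product of the
binomial series in `w` and its conjugate, only the diagonal terms have non-zero integral. -/
theorem integral_one_div_norm_one_add_mul_exp {x : ℝ} (hx0 : 0 ≤ x) (hx : x < 1) :
    ∫ y in 0..Real.pi, 1 / ‖1 + x * Complex.exp (2 * Complex.I * y)‖ =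
      Real.pi * ordinaryHypergeometric (1 / 2 : ℝ) (1 / 2 : ℝ) (1 : ℝ) (x ^ 2) := by
  have hnorm (y : ℝ) : ‖-(x * Complex.exp (2 * Complex.I * y))‖ = x := by
    rw [norm_neg, norm_mul, Complex.norm_of_nonneg hx0, Complex.norm_exp]
    simp
  have hf (y : ℝ) : HasSum (fun p : ℕ × ℕ ↦
      (invSqrtCoeff p.1 * (-(x * Complex.exp (2 * Complex.I * y))) ^ p.1) *
        (starRingEnd ℂ) (invSqrtCoeff p.2 * (-(x * Complex.exp (2 * Complex.I * y))) ^ p.2))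
      ((1 / ‖1 + x * Complex.exp (2 * Complex.I * y)‖ : ℝ) : ℂ) := by
    have h := hasSum_mul_conj_of_hasSum
      (hasSum_invSqrtCoeff_mul_pow (z := -(x * Complex.exp (2 * Complex.I * y)))
        (by rwa [hnorm]))
    rwa [norm_one_div_cpow_half_sq, sub_neg_eq_add] at h
  have h := hasSum_integral_of_norm_le (u := 0) (v := Real.pi)
    (b := fun p : ℕ × ℕ ↦ x ^ p.1 * x ^ p.2)
    (fun p ↦ by fun_prop) (fun p y ↦ by
      rw [norm_mul, RCLike.norm_conj, norm_mul, norm_mul, norm_pow, norm_pow, hnorm,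
        Complex.norm_of_nonneg (invSqrtCoeff_nonneg _),
        Complex.norm_of_nonneg (invSqrtCoeff_nonneg _)]
      have h1 (n : ℕ) : invSqrtCoeff n * x ^ n ≤ x ^ n :=
        mul_le_of_le_one_left (pow_nonneg hx0 n) (invSqrtCoeff_le_one n)
      exact mul_le_mul (h1 _) (h1 _) (mul_nonneg (invSqrtCoeff_nonneg _) (pow_nonneg hx0 _))
        (pow_nonneg hx0 _))
    ((summable_geometric_of_lt_one hx0 hx).mul_of_nonneg (summable_geometric_of_lt_one hx0 hx)
      (fun _ ↦ pow_nonneg hx0 _) (fun _ ↦ pow_nonneg hx0 _)) hf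
  -- Orthogonality of the exponentials `exp (2iky)` on `[0, π]`.
  have hint (p : ℕ × ℕ) : ∫ y in 0..Real.pi,
      (invSqrtCoeff p.1 * (-(x * Complex.exp (2 * Complex.I * y))) ^ p.1) *
        (starRingEnd ℂ) (invSqrtCoeff p.2 * (-(x * Complex.exp (2 * Complex.I * y))) ^ p.2) =
      if p.1 = p.2 then ((Real.pi * (invSqrtCoeff p.1 ^ 2 * (x ^ 2) ^ p.1) : ℝ) : ℂ) else 0 := by
    obtain ⟨m, n⟩ := p
    have he (y : ℝ) : (invSqrtCoeff m * (-(x * Complex.exp (2 * Complex.I * y))) ^ m) *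
        (starRingEnd ℂ) (invSqrtCoeff n * (-(x * Complex.exp (2 * Complex.I * y))) ^ n) =
        (invSqrtCoeff m * invSqrtCoeff n * (-x) ^ (m + n) : ℂ) *
          Complex.exp (2 * ((m - n : ℤ) : ℂ) * Complex.I * y) := by
      have h1 : Complex.exp (2 * ((m - n : ℤ) : ℂ) * Complex.I * y) =
          Complex.exp (2 * Complex.I * y) ^ m * Complex.exp (-(2 * Complex.I * y)) ^ n := by
        rw [← Complex.exp_nat_mul, ← Complex.exp_nat_mul, ← Complex.exp_add]
        congr 1
        push_cast
        ring
      rw [h1, map_mul, map_pow, map_neg, map_mul, ← Complex.exp_conj]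
      simp only [map_mul, Complex.conj_ofReal, Complex.conj_I, map_ofNat]
      rw [show (2 * -Complex.I * (y : ℂ)) = -(2 * Complex.I * y) by ring,
        neg_mul_eq_neg_mul, neg_mul_eq_neg_mul, mul_pow, mul_pow, pow_add]
      ring
    simp only [he]
    rw [intervalIntegral.integral_const_mul, integral_exp_two_mul_int_mul_I]
    by_cases hmn : m = n
    · subst hmn
      simp only [sub_self, if_true, ← two_mul, pow_mul, neg_sq]
      push_cast
      ring
    · rw [if_neg (by omega), if_neg hmn, mul_zero]
  simp only [hint] at h
  have hinj : Function.Injective fun n : ℕ ↦ (n, n) := fun _ _ h ↦ (Prod.ext_iff.mp h).1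
  have h2 := (hinj.hasSum_iff (fun p hp ↦ if_neg fun h' ↦ hp ⟨p.1, Prod.ext rfl h'⟩)).mpr h
  simp only [Function.comp_def, if_true] at h2
  rw [intervalIntegral.integral_ofReal] at h2
  have h3 := Complex.hasSum_ofReal.mp h2
  exact h3.unique ((hasSum_ordinaryHypergeometric_half_half_one
    (by rw [abs_of_nonneg (sq_nonneg x)]; exact pow_lt_one₀ hx0 hx two_ne_zero)).mul_left Real.pi)

lemma norm_one_add_mul_exp_sq (x y : ℝ) :
    ‖1 + x * Complex.exp (2 * Complex.I * y)‖ ^ 2 = (1 + x) ^ 2 - 4 * x * Real.sin y ^ 2 := by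
  have h1 := Real.cos_two_mul y
  have h2 := Real.sin_sq_add_cos_sq y
  have h3 := Real.sin_sq_add_cos_sq (2 * y)
  rw [show 2 * Complex.I * (y : ℂ) = ((2 * y : ℝ) : ℂ) * Complex.I by push_cast; ring,
    ← Complex.normSq_eq_norm_sq, Complex.normSq_apply]
  simp only [Complex.add_re, Complex.add_im, Complex.one_re, Complex.one_im, Complex.re_ofReal_mul,
    Complex.im_ofReal_mul, Complex.exp_ofReal_mul_I_re, Complex.exp_ofReal_mul_I_im]
  linear_combination 2 * x * h1 + x ^ 2 * h3 + 4 * x * h2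

/-- Gauss' form of Landen's transformation: `F (4x / (1 + x)²) = (1 + x) F (x²)` for
`F = ₂F₁(1/2, 1/2; 1; ·)`. Up to a factor `π` both sides are integrals over `[0, π]` with the same
integrand, since `‖1 + x exp (2iy)‖² = (1 + x)² - 4x sin² y`. -/
theorem ordinaryHypergeometric_landen {x : ℝ} (hx0 : 0 ≤ x) (hx : x < 1) :
    ordinaryHypergeometric (1 / 2 : ℝ) (1 / 2 : ℝ) (1 : ℝ) (4 * x / (1 + x) ^ 2) =
      (1 + x) * ordinaryHypergeometric (1 / 2 : ℝ) (1 / 2 : ℝ) (1 : ℝ) (x ^ 2) := by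
  have hx1 : 0 < 1 + x := by linarith
  have hm : 4 * x / (1 + x) ^ 2 < 1 := by
    rw [div_lt_one (by positivity)]
    nlinarith [mul_pos (sub_pos.mpr hx) (sub_pos.mpr hx)]
  have h1 := integral_one_div_sqrt_one_sub_mul_sin_sq (m := 4 * x / (1 + x) ^ 2) (by positivity) hm
  have h2 := integral_one_div_norm_one_add_mul_exp hx0 hx
  have he (y : ℝ) : 1 / √(1 - 4 * x / (1 + x) ^ 2 * Real.sin y ^ 2) =
      (1 + x) * (1 / ‖1 + x * Complex.exp (2 * Complex.I * y)‖) := by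
    have hsq : 1 - 4 * x / (1 + x) ^ 2 * Real.sin y ^ 2 =
        (‖1 + x * Complex.exp (2 * Complex.I * y)‖ / (1 + x)) ^ 2 := by
      rw [div_pow, norm_one_add_mul_exp_sq]
      field_simp
    rw [hsq, Real.sqrt_sq (by positivity), one_div_div, div_eq_mul_one_div]
  simp only [he] at h1
  rw [intervalIntegral.integral_const_mul, h2] at h1
  refine mul_left_cancel₀ Real.pi_ne_zero ?_
  rw [← h1]
  ring

lemma tendsto_ordinaryHypergeometric_half_half_one :
    Filter.Tendsto (ordinaryHypergeometric (1 / 2 : ℝ) (1 / 2 : ℝ) (1 : ℝ)) (nhds (0 : ℝ))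
      (nhds 1) := by
  have hp : HasFPowerSeriesOnBall (ordinaryHypergeometric (1 / 2 : ℝ) (1 / 2 : ℝ) (1 : ℝ))
      (ordinaryHypergeometricSeries ℝ (1 / 2 : ℝ) (1 / 2 : ℝ) (1 : ℝ)) 0
      (ordinaryHypergeometricSeries ℝ (1 / 2 : ℝ) (1 / 2 : ℝ) (1 : ℝ)).radius := by
    refine FormalMultilinearSeries.hasFPowerSeriesOnBall _ ?_
    rw [ordinaryHypergeometricSeries_radius_eq_one]
    · exact one_pos
    · intro k
      have : (0 : ℝ) ≤ k := k.cast_nonneg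
      refine ⟨?_, ?_, ?_⟩ <;> intro h <;> linarith
  have := hp.continuousOn.continuousAt (Metric.eball_mem_nhds 0 hp.r_pos)
  simpa [ContinuousAt] using this
/-! ### The theta constant as a hypergeometric value -/

/-- Invariance under `t ↦ 2t`, which acts on `(a, b) = (θ(0, t)², θ(1/2, t)²)` as a step of the
arithmetic-geometric mean. -/
lemma ordinaryHypergeometric_div_theta_zero_sq (ht : 0 < t) :
    ordinaryHypergeometric (1 / 2 : ℝ) (1 / 2 : ℝ) (1 : ℝ)
        (1 - (theta (1 / 2) t ^ 2 / theta 0 t ^ 2) ^ 2) / theta 0 t ^ 2 =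
      ordinaryHypergeometric (1 / 2 : ℝ) (1 / 2 : ℝ) (1 : ℝ)
        (1 - (theta (1 / 2) (2 * t) ^ 2 / theta 0 (2 * t) ^ 2) ^ 2) / theta 0 (2 * t) ^ 2 := by
  have h0 := theta_pos 0 ht
  have hh := theta_pos (1 / 2) ht
  have h02 := theta_pos 0 (mul_pos two_pos ht)
  have hlt := pow_lt_pow_left₀ (theta_half_lt_theta_zero ht) hh.le two_ne_zero
  have hadd := theta_sq_add_theta_half_sq ht
  have hmul := theta_zero_mul_theta_half ht
  have hmul2 : theta (1 / 2) (2 * t) ^ 4 = theta 0 t ^ 2 * theta (1 / 2) t ^ 2 := by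
    rw [← mul_pow, hmul]; ring
  have hadd2 : theta 0 (2 * t) ^ 2 = (theta 0 t ^ 2 + theta (1 / 2) t ^ 2) / 2 := by linarith
  set a := theta 0 t ^ 2
  set b := theta (1 / 2) t ^ 2
  have ha : 0 < a := pow_pos h0 2
  have hb : 0 < b := pow_pos hh 2
  have hx0 : 0 ≤ (a - b) / (a + b) := div_nonneg (sub_nonneg.mpr hlt.le) (by positivity)
  have hx1 : (a - b) / (a + b) < 1 := (div_lt_one (by positivity)).mpr (by linarith)
  -- For `x = (a - b) / (a + b)`, `4x / (1 + x)² = 1 - (b / a)²`, and `x²` is the same expression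
  -- in the two means.
  have h := ordinaryHypergeometric_landen hx0 hx1
  have e1 : 1 + (a - b) / (a + b) = 2 * a / (a + b) := by field_simp; ring
  have e2 : 4 * ((a - b) / (a + b)) / (1 + (a - b) / (a + b)) ^ 2 = 1 - (b / a) ^ 2 := by
    rw [e1]; field_simp; ring
  have e3 : ((a - b) / (a + b)) ^ 2 =
      1 - (theta (1 / 2) (2 * t) ^ 2 / theta 0 (2 * t) ^ 2) ^ 2 := by
    rw [div_pow (theta (1 / 2) (2 * t) ^ 2), ← pow_mul, hmul2, hadd2]; field_simp; ring
  rw [e2, e1, e3] at h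
  rw [h, hadd2]
  field_simp

theorem theta_zero_sq_eq_ordinaryHypergeometric (ht : 0 < t) :
    theta 0 t ^ 2 = ordinaryHypergeometric (1 / 2 : ℝ) (1 / 2 : ℝ) (1 : ℝ)
      (1 - (theta (1 / 2) t ^ 2 / theta 0 t ^ 2) ^ 2) := by
  have hinv (n : ℕ) : ordinaryHypergeometric (1 / 2 : ℝ) (1 / 2 : ℝ) (1 : ℝ)
        (1 - (theta (1 / 2) (2 ^ n * t) ^ 2 / theta 0 (2 ^ n * t) ^ 2) ^ 2) /
          theta 0 (2 ^ n * t) ^ 2 =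
      ordinaryHypergeometric (1 / 2 : ℝ) (1 / 2 : ℝ) (1 : ℝ)
        (1 - (theta (1 / 2) t ^ 2 / theta 0 t ^ 2) ^ 2) / theta 0 t ^ 2 := by
    induction n with
    | zero => simp
    | succ n ih =>
      rw [← ih, ordinaryHypergeometric_div_theta_zero_sq (t := 2 ^ n * t) (by positivity),
        ← mul_assoc, ← pow_succ']
  have h0 := tendsto_theta_zero_two_pow_mul ht
  have hh : Filter.Tendsto (fun n : ℕ ↦ theta (1 / 2) (2 ^ n * t)) Filter.atTop (nhds 1) := by
    refine tendsto_of_tendsto_of_tendsto_of_le_of_le (g := fun n : ℕ ↦ 2 - theta 0 (2 ^ n * t))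
      ?_ h0 (fun n ↦ two_sub_theta_zero_le _ (by positivity))
      (fun n ↦ theta_le_theta_zero _ (by positivity))
    have := h0.const_sub 2
    norm_num at this
    exact this
  have harg := (((hh.pow 2).div (h0.pow 2) (by norm_num)).pow 2).const_sub 1
  norm_num at harg
  have hlim := (tendsto_ordinaryHypergeometric_half_half_one.comp harg).div (h0.pow 2)
    (by norm_num)
  have hc := tendsto_nhds_unique hlim
    (tendsto_const_nhds.congr fun n ↦ by simpa using (hinv n).symm)
  have hpos := pow_pos (theta_pos 0 ht) 2
  rw [one_pow, div_one, eq_div_iff hpos.ne', one_mul] at hc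
  simpa using hc

/-! ### The heat kernel as a product of theta functions -/

lemma unitHeatKernel_coe (ht : 0 < t) (a b c d : ℝ) :
    unitHeatKernel 1 t ((a : AddCircle ((1 : ℝ)⁻¹ / √t)), (b : AddCircle ((1 : ℝ) / √t)))
      ((c : AddCircle ((1 : ℝ)⁻¹ / √t)), (d : AddCircle ((1 : ℝ) / √t))) =
      ((theta (√t * (a - c)) t * theta (√t * (b - d)) t : ℝ) : ℂ) := by
  have h := hasSum_jacobiTheta₂_term_mul (√t * (a - c) : ℝ) (√t * (b - d) : ℝ)
    (im_ofReal_mul_I_pos ht)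
  rw [← ofReal_theta, ← ofReal_theta, ← Complex.ofReal_mul] at h
  rw [unitHeatKernel, heatKernel, ← h.tsum_eq]
  refine tsum_congr fun n ↦ ?_
  have hsqrt : (√t : ℂ) ≠ 0 := by exact_mod_cast (Real.sqrt_pos.mpr ht).ne'
  simp only [eigenfunction, eigenvalue, fourier_coe_apply, jacobiTheta₂_term,
    ← Complex.exp_conj, Complex.ofReal_exp, ← Complex.exp_add]
  congr 1
  simp only [map_add, map_div₀, map_mul, Complex.conj_ofReal, Complex.conj_I, map_ofNat, map_intCast]
  push_cast
  have hpi : (Real.pi : ℂ) ≠ 0 := by exact_mod_cast Real.pi_ne_zero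
  field_simp
  ring_nf
  simp only [Complex.I_sq]
  ring

lemma exists_unitHeatKernel_eq (ht : 0 < t) (P Q : Torus 1 t) :
    ∃ x y : ℝ, unitHeatKernel 1 t P Q = ((theta x t * theta y t : ℝ) : ℂ) := by
  obtain ⟨p₁, p₂⟩ := P
  obtain ⟨q₁, q₂⟩ := Q
  induction p₁ using QuotientAddGroup.induction_on with | H a
  induction p₂ using QuotientAddGroup.induction_on with | H b
  induction q₁ using QuotientAddGroup.induction_on with | H c
  induction q₂ using QuotientAddGroup.induction_on with | H d
  exact ⟨_, _, unitHeatKernel_coe ht a b c d⟩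

lemma theta_mul_theta_mem_temperatures (ht : 0 < t) (x y : ℝ) :
    theta x t * theta y t ∈ temperatures 1 t := by
  have hsqrt := (Real.sqrt_pos.mpr ht).ne'
  refine ⟨(((x / √t : ℝ), (y / √t : ℝ)), ((0 : ℝ), (0 : ℝ))), ?_⟩
  simp only [unitHeatKernel_coe ht, sub_zero, Complex.ofReal_re]
  rw [mul_div_cancel₀ _ hsqrt, mul_div_cancel₀ _ hsqrt]

lemma isLeast_temperatures (ht : 0 < t) :
    IsLeast (temperatures 1 t) (theta (1 / 2) t ^ 2) := by
  refine ⟨pow_two (theta (1 / 2) t) ▸ theta_mul_theta_mem_temperatures ht _ _, ?_⟩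
  rintro _ ⟨⟨P, Q⟩, rfl⟩
  obtain ⟨x, y, h⟩ := exists_unitHeatKernel_eq ht P Q
  simp only [h, Complex.ofReal_re, pow_two]
  exact mul_le_mul (theta_half_le x ht) (theta_half_le y ht) (theta_pos _ ht).le (theta_pos _ ht).le

lemma isGreatest_temperatures (ht : 0 < t) :
    IsGreatest (temperatures 1 t) (theta 0 t ^ 2) := by
  refine ⟨pow_two (theta 0 t) ▸ theta_mul_theta_mem_temperatures ht _ _, ?_⟩
  rintro _ ⟨⟨P, Q⟩, rfl⟩
  obtain ⟨x, y, h⟩ := exists_unitHeatKernel_eq ht P Q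
  simp only [h, Complex.ofReal_re, pow_two]
  exact mul_le_mul (theta_le_theta_zero x ht) (theta_le_theta_zero y ht) (theta_pos _ ht).le
    (theta_pos _ ht).le

end RectTorus

theorem mainTheorem2 (t : ℝ) (ht : 0 < t) (k' : ℝ)
    (hk' : k' = RectTorus.coldest 1 t / RectTorus.hottest 1 t) :
    (∀ P Q : RectTorus.Torus 1 t, (RectTorus.unitHeatKernel 1 t P Q).im = 0) ∧
    IsLeast (RectTorus.temperatures 1 t) (RectTorus.coldest 1 t) ∧
    IsGreatest (RectTorus.temperatures 1 t) (RectTorus.hottest 1 t) ∧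
    k' ∈ Set.Ioo (0 : ℝ) 1 ∧
    RectTorus.hottest 1 t = RectTorus.theta3 (Real.exp (-(Real.pi * t))) ^ 2 ∧
    RectTorus.hottest 1 t =
      ordinaryHypergeometric (1 / 2 : ℝ) (1 / 2 : ℝ) (1 : ℝ) (1 - k' ^ 2) ∧
    RectTorus.coldest 1 t =
      k' * ordinaryHypergeometric (1 / 2 : ℝ) (1 / 2 : ℝ) (1 : ℝ) (1 - k' ^ 2) ∧
    k' ^ 2 = RectTorus.theta4 (Real.exp (-(Real.pi * t))) ^ 4 /
      RectTorus.theta3 (Real.exp (-(Real.pi * t))) ^ 4 ∧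
    k' ^ 2 = RectTorus.coldest 1 t ^ 2 / RectTorus.hottest 1 t ^ 2 := by
  have hmin := RectTorus.isLeast_temperatures ht
  have hmax := RectTorus.isGreatest_temperatures ht
  have hA : RectTorus.coldest 1 t = RectTorus.theta (1 / 2) t ^ 2 := hmin.csInf_eq
  have hB : RectTorus.hottest 1 t = RectTorus.theta 0 t ^ 2 := hmax.csSup_eq
  have h0 := RectTorus.theta_pos 0 ht
  have hh := RectTorus.theta_pos (1 / 2) ht
  have hlt := pow_lt_pow_left₀ (RectTorus.theta_half_lt_theta_zero ht) hh.le two_ne_zero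
  have hF := RectTorus.theta_zero_sq_eq_ordinaryHypergeometric ht
  rw [hA, hB] at hk'
  rw [← hk'] at hF
  rw [hA, hB, RectTorus.theta3_eq ht, RectTorus.theta4_eq ht, ← hF]
  refine ⟨fun P Q ↦ ?_, hmin, hmax, ?_, rfl, rfl, ?_, ?_, ?_⟩
  · obtain ⟨x, y, h⟩ := RectTorus.exists_unitHeatKernel_eq ht P Q
    rw [h, Complex.ofReal_im]
  · rw [hk']
    exact ⟨by positivity, (div_lt_one (by positivity)).mpr hlt⟩
  · rw [hk', div_mul_cancel₀ _ (pow_pos h0 2).ne']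
  · rw [hk', div_pow, ← pow_mul, ← pow_mul]
  · rw [hk', div_pow]
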